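/- Let $n\ge 2$ and $m\ge 0$ be integers. Let $\mathcal E'(\mathbb R^n)$ be the space of compactly supported (complex-valued) distributions on $\mathbb R^n$, i.e. the continuous dual of $C^\infty(\mathbb R^n)$. Let $\mathcal E'(S^p)$ be the space of compactly supported symmetric $p$-tensor field distributions, i.e. families $f=(f_{i_1\cdots i_p})_{1\le i_1,\dots,i_p\le n}$ of elements of $\mathcal E'(\mathbb R^n)$ that are invariant under permutations of the indices, and let $\mathcal E'(\mathbf S^m)=\bigoplus_{p=0}^m\mathcal E'(S^p)$, with elements $F=(f^{(0)},\dots,f^{(m)})$. For an integer $k\ge 0$, the $k$-th momentum ray transform of $F$ is the distribution $I^{m,k}F$ on $\mathbb R^n\times(\mathbb R^n\setminus\{0\})$ given, for $\Psi\in C_c^\infty(\mathbb R^n\times(\mathbb R^n\setminus\{0\}))$, by $$\langle I^{m,k}F,\Psi\rangle=\sum_{p=0}^m\ \sum_{i_1,\dots,i_p=1}^n\Big\langle f^{(p)}_{i_1\cdots i_p}\,,\ x\mapsto\int_{\mathbb R^n}\int_{\mathbb R}t^k\,\xi^{i_1}\cdots\xi^{i_p}\,\Psi(x-t\xi,\xi)\,dt\,d\xi\Big\rangle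 ;$$ for smooth compactly supported $F$ this is the function $I^{m,k}F(x,\xi)=\int_{\mathbb R}t^k\sum_{p=0}^m\sum_{i_1,\dots,i_p}f^{(p)}_{i_1\cdots i_p}(x+t\xi)\,\xi^{i_1}\cdots\xi^{i_p}\,dt$. Theorem. Let $F\in\mathcal E'(\mathbf S^m)$. If $I^{m,m}F=0$ on $\mathbb R^n\times(\mathbb R^n\setminus\{0\})$, then $F=0$. -/

import Mathlib

open scoped ContDiff

noncomputable section

namespace MomentumRay

/-- Euclidean space `ℝⁿ`. -/
abbrev Space (n : ℕ) : Type := EuclideanSpace ℝ (Fin n)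

/-- The space `C^∞(ℝⁿ)` of smooth complex-valued functions. -/
def SmoothFun (n : ℕ) : Submodule ℂ (Space n → ℂ) where
  carrier := {φ | ContDiff ℝ ∞ φ}
  zero_mem' := (contDiff_const : ContDiff ℝ ∞ fun _ : Space n => (0 : ℂ))
  add_mem' := fun {_ _} hφ hψ => ContDiff.add (𝕜 := ℝ) (n := ∞) hφ hψ
  smul_mem' := fun c _ hφ => ContDiff.const_smul (𝕜 := ℝ) (n := ∞) c hφ

/-- Continuity of a linear functional on `C^∞(ℝⁿ)` for its usual Fréchet topology: there are a
compact set `K`, an order `N` and a constant `C` such that `|T φ| ≤ C M` as soon as all derivatives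
of `φ` of order at most `N` are bounded by `M` on `K`. -/
def IsContinuousFunctional {n : ℕ} (T : SmoothFun n →ₗ[ℂ] ℂ) : Prop :=
  ∃ (K : Set (Space n)) (N : ℕ) (C : ℝ), IsCompact K ∧ 0 ≤ C ∧
    ∀ (φ : SmoothFun n) (M : ℝ), 0 ≤ M →
      (∀ j ≤ N, ∀ x ∈ K, ‖iteratedFDeriv ℝ j (φ : Space n → ℂ) x‖ ≤ M) → ‖T φ‖ ≤ C * M

/-- The space `𝓔'(ℝⁿ)` of compactly supported distributions, as the dual of `C^∞(ℝⁿ)`. -/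
def CompactDistribution (n : ℕ) : Submodule ℂ (SmoothFun n →ₗ[ℂ] ℂ) where
  carrier := {T | IsContinuousFunctional T}
  zero_mem' := ⟨∅, 0, 0, isCompact_empty, le_rfl, fun φ M _ _ => by simp⟩
  add_mem' := by
    rintro S T ⟨K, N, C, hK, hC, hS⟩ ⟨K', N', C', hK', hC', hT⟩
    refine ⟨K ∪ K', max N N', C + C', hK.union hK', add_nonneg hC hC', fun φ M hM h => ?_⟩
    have h1 := hS φ M hM fun j hj x hx => h j (hj.trans (le_max_left _ _)) x (Or.inl hx)
    have h2 := hT φ M hM fun j hj x hx => h j (hj.trans (le_max_right _ _)) x (Or.inr hx)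
    calc ‖(S + T) φ‖ ≤ ‖S φ‖ + ‖T φ‖ := norm_add_le _ _
      _ ≤ (C + C') * M := by linarith
  smul_mem' := by
    rintro c T ⟨K, N, C, hK, hC, hT⟩
    refine ⟨K, N, ‖c‖ * C, hK, mul_nonneg (norm_nonneg _) hC, fun φ M hM h => ?_⟩
    rw [LinearMap.smul_apply, norm_smul, mul_assoc]
    exact mul_le_mul_of_nonneg_left (hT φ M hM h) (norm_nonneg _)

/-- The space `𝓔'(S^p)` of compactly supported symmetric `p`-tensor field distributions: families
`f_{i₁…i_p}` of compactly supported distributions that are invariant under all permutations of the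
indices. -/
def SymTensorDistribution (n p : ℕ) : Submodule ℂ ((Fin p → Fin n) → CompactDistribution n) where
  carrier := {f | ∀ (σ : Equiv.Perm (Fin p)) (i : Fin p → Fin n), f (i ∘ σ) = f i}
  zero_mem' := fun _ _ => rfl
  add_mem' := fun hf hg σ i => by rw [Pi.add_apply, Pi.add_apply, hf σ i, hg σ i]
  smul_mem' := fun c f hf σ i => by rw [Pi.smul_apply, Pi.smul_apply, hf σ i]

/-- The space `𝓔'(𝐒^m) = 𝓔'(S^0) ⊕ 𝓔'(S^1) ⊕ ⋯ ⊕ 𝓔'(S^m)`; an element is the tuple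
`F = (f^(0), f^(1), …, f^(m))`. -/
abbrev MixedTensorDistribution (n m : ℕ) : Type :=
  (p : Fin (m + 1)) → SymTensorDistribution n p

/-- The open set `ℝⁿ × (ℝⁿ ∖ {0})`. -/
def PhaseSpace (n : ℕ) : TopologicalSpace.Opens (Space n × Space n) where
  carrier := {z | z.2 ≠ 0}
  is_open' := isOpen_ne_fun continuous_snd continuous_const

/-- The space `C_c^∞(ℝⁿ × (ℝⁿ ∖ {0}))` of complex-valued test functions. -/
abbrev PhaseTest (n : ℕ) : Type := TestFunction (PhaseSpace n) ℂ ⊤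

/-- The integrand `t^k ξ^{i₁} ⋯ ξ^{i_p} Ψ(x - tξ, ξ)`. -/
def adjointIntegrand {n p : ℕ} (k : ℕ) (i : Fin p → Fin n) (Ψ : PhaseTest n)
    (x : Space n) (ξ : Space n) (t : ℝ) : ℂ :=
  ((t ^ k * ∏ j, ξ (i j) : ℝ) : ℂ) * Ψ (x - t • ξ, ξ)

/-- The `(i₁,…,i_p)` component of the adjoint `(I^k)^* Ψ` as a function on `ℝⁿ`:
`x ↦ ∫_{ℝⁿ} ∫_ℝ t^k ξ^{i₁} ⋯ ξ^{i_p} Ψ(x - tξ, ξ) dt dξ`. -/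
def adjointFun {n p : ℕ} (k : ℕ) (i : Fin p → Fin n) (Ψ : PhaseTest n) (x : Space n) : ℂ :=
  ∫ ξ : Space n, ∫ t : ℝ, adjointIntegrand k i Ψ x ξ t

theorem contDiff_adjointIntegrand {n p : ℕ} (k : ℕ) (i : Fin p → Fin n) (Ψ : PhaseTest n) :
    ContDiff ℝ ∞ (fun q : Space n × (Space n × ℝ) => adjointIntegrand k i Ψ q.1 q.2.1 q.2.2) := by
  have hΨ : ContDiff ℝ ∞ (Ψ : Space n × Space n → ℂ) := Ψ.contDiff
  have hcoord : ∀ j : Fin p,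
      ContDiff ℝ ∞ (fun q : Space n × (Space n × ℝ) => q.2.1 (i j)) := fun j =>
    (EuclideanSpace.proj (i j) : Space n →L[ℝ] ℝ).contDiff.comp
      (contDiff_fst.comp contDiff_snd)
  have h1 : ContDiff ℝ ∞ (fun q : Space n × (Space n × ℝ) =>
      q.2.2 ^ k * ∏ j, q.2.1 (i j)) :=
    ((contDiff_snd.comp contDiff_snd).pow k).mul (contDiff_prod fun j _ => hcoord j)
  have h2 : ContDiff ℝ ∞ (fun q : Space n × (Space n × ℝ) =>
      Ψ (q.1 - q.2.2 • q.2.1, q.2.1)) :=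
    hΨ.comp (by fun_prop)
  exact (Complex.ofRealCLM.contDiff.comp h1).mul h2

/-- For `x` in a bounded set, the integrand is supported in a fixed compact set of pairs `(ξ, t)`. -/
theorem exists_compact_adjointIntegrand {n p : ℕ} (k : ℕ) (i : Fin p → Fin n) (Ψ : PhaseTest n)
    (R : ℝ) : ∃ K : Set (Space n × ℝ), IsCompact K ∧
      ∀ x ∈ Metric.ball (0 : Space n) R, ∀ z : Space n × ℝ, z ∉ K →
        adjointIntegrand k i Ψ x z.1 z.2 = 0 := by
  let g : Space n × (Space n × Space n) → Space n × ℝ :=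
    fun w => (w.2.2, inner ℝ (w.1 - w.2.1) w.2.2 / ‖w.2.2‖ ^ 2)
  refine ⟨g '' (Metric.closedBall (0 : Space n) R ×ˢ tsupport Ψ), ?_, ?_⟩
  · refine ((isCompact_closedBall (0 : Space n) R).prod Ψ.hasCompactSupport).image_of_continuousOn ?_
    refine ContinuousOn.prodMk (by fun_prop) (ContinuousOn.div (by fun_prop) (by fun_prop) ?_)
    intro w hw
    have hne : w.2.2 ≠ 0 := Ψ.tsupport_subset hw.2
    exact pow_ne_zero _ (norm_ne_zero_iff.2 hne)
  · intro x hx z hz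
    by_contra hne
    apply hz
    have hΨ : Ψ (x - z.2 • z.1, z.1) ≠ 0 := fun h => hne (by simp [adjointIntegrand, h])
    have hmem : (x - z.2 • z.1, z.1) ∈ tsupport Ψ := subset_tsupport _ hΨ
    have h0 : z.1 ≠ 0 := Ψ.tsupport_subset hmem
    refine ⟨(x, (x - z.2 • z.1, z.1)), ⟨Metric.ball_subset_closedBall hx, hmem⟩, ?_⟩
    have h1 : ‖z.1‖ ^ 2 ≠ 0 := pow_ne_zero _ (norm_ne_zero_iff.2 h0)
    refine Prod.ext rfl ?_
    simp only [g, sub_sub_cancel, real_inner_smul_left, real_inner_self_eq_norm_sq]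
    field_simp

theorem integrable_adjointIntegrand {n p : ℕ} (k : ℕ) (i : Fin p → Fin n) (Ψ : PhaseTest n)
    (x : Space n) :
    MeasureTheory.Integrable (fun z : Space n × ℝ => adjointIntegrand k i Ψ x z.1 z.2) := by
  obtain ⟨K, hK, h⟩ := exists_compact_adjointIntegrand k i Ψ (‖x‖ + 1)
  refine Continuous.integrable_of_hasCompactSupport ?_ ?_
  · exact (contDiff_adjointIntegrand k i Ψ).continuous.comp (Continuous.prodMk_right x)
  · exact HasCompactSupport.intro hK fun z hz => h x (by simp) z hz

theorem adjointFun_eq_integral_prod {n p : ℕ} (k : ℕ) (i : Fin p → Fin n) (Ψ : PhaseTest n)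
    (x : Space n) :
    adjointFun k i Ψ x = ∫ z : Space n × ℝ, adjointIntegrand k i Ψ x z.1 z.2 :=
  (MeasureTheory.integral_prod _ (integrable_adjointIntegrand k i Ψ x)).symm

theorem contDiff_adjointFun {n p : ℕ} (k : ℕ) (i : Fin p → Fin n) (Ψ : PhaseTest n) :
    ContDiff ℝ ∞ (adjointFun k i Ψ) := by
  rw [contDiff_iff_contDiffAt]
  intro x
  obtain ⟨K, hK, h⟩ := exists_compact_adjointIntegrand k i Ψ (‖x‖ + 1)
  have key := MeasureTheory.contDiffOn_convolution_right_with_param_comp (𝕜 := ℝ) (n := ⊤)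
    (μ := (MeasureTheory.volume : MeasureTheory.Measure (Space n × ℝ)))
    (ContinuousLinearMap.lsmul ℝ ℝ : ℝ →L[ℝ] ℂ →L[ℝ] ℂ)
    (s := Metric.ball (0 : Space n) (‖x‖ + 1)) (v := fun _ => (0 : Space n × ℝ))
    contDiffOn_const (f := fun _ => (1 : ℝ))
    (g := fun y z => adjointIntegrand k i Ψ y (-z).1 (-z).2) (k := -K)
    Metric.isOpen_ball hK.neg
    (fun y z hy hz => h y hy (-z) (by simpa using hz))
    (MeasureTheory.locallyIntegrable_const _)
    (((contDiff_adjointIntegrand k i Ψ).comp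
      (contDiff_fst.prodMk contDiff_snd.neg)).contDiffOn)
  have heq : adjointFun k i Ψ = fun y : Space n => MeasureTheory.convolution
      (fun _ : Space n × ℝ => (1 : ℝ))
      (fun z : Space n × ℝ => adjointIntegrand k i Ψ y (-z).1 (-z).2)
      (ContinuousLinearMap.lsmul ℝ ℝ : ℝ →L[ℝ] ℂ →L[ℝ] ℂ) MeasureTheory.volume 0 := by
    funext y
    rw [adjointFun_eq_integral_prod, MeasureTheory.convolution]
    simp
  rw [heq]
  exact key.contDiffAt (Metric.isOpen_ball.mem_nhds (by simp))

/-- The `(i₁,…,i_p)` component of the adjoint `(I^k)^*`, as a linear map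
`C_c^∞(ℝⁿ × (ℝⁿ ∖ {0})) → C^∞(ℝⁿ)`. -/
def adjoint {n p : ℕ} (k : ℕ) (i : Fin p → Fin n) : PhaseTest n →ₗ[ℂ] SmoothFun n where
  toFun Ψ := ⟨adjointFun k i Ψ, contDiff_adjointFun k i Ψ⟩
  map_add' Ψ Φ := by
    apply Subtype.ext
    funext x
    simp only [Submodule.coe_add, Pi.add_apply, adjointFun_eq_integral_prod]
    rw [← MeasureTheory.integral_add (integrable_adjointIntegrand k i Ψ x)
      (integrable_adjointIntegrand k i Φ x)]
    simp [adjointIntegrand, mul_add]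
  map_smul' c Ψ := by
    apply Subtype.ext
    funext x
    simp only [Submodule.coe_smul, Pi.smul_apply, adjointFun_eq_integral_prod, RingHom.id_apply]
    rw [← MeasureTheory.integral_smul]
    simp [adjointIntegrand, mul_left_comm]

/-- The momentum ray transform `I^k f` of `f ∈ 𝓔'(S^p)`, as a linear functional on
`C_c^∞(ℝⁿ × (ℝⁿ ∖ {0}))`: `⟨I^k f, Ψ⟩ = ⟨f, (I^k)^* Ψ⟩ = ∑_{i₁,…,i_p} ⟨f_{i₁…i_p}, [(I^k)^* Ψ]_{i₁…i_p}⟩`. -/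
def tensorMRT {n p : ℕ} (k : ℕ) (f : SymTensorDistribution n p) : PhaseTest n →ₗ[ℂ] ℂ :=
  ∑ i : Fin p → Fin n, (f.1 i).1 ∘ₗ adjoint k i

/-- The momentum ray transform `I^{m,k} F = ∑_{p=0}^m I^k f^(p)` of `F ∈ 𝓔'(𝐒^m)`, as a linear
functional on `C_c^∞(ℝⁿ × (ℝⁿ ∖ {0}))`. -/
def MRT {n m : ℕ} (k : ℕ) (F : MixedTensorDistribution n m) : PhaseTest n →ₗ[ℂ] ℂ :=
  ∑ p : Fin (m + 1), tensorMRT k (F p)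

end MomentumRay

end

noncomputable section

namespace MomentumRay

open MeasureTheory Function

/-! Fix a skew map `A` and test the transform against functions carrying the phase `exp(i⟨y, Aξ⟩)`.
Since `Aξ ⟂ ξ`, this phase is constant on lines of direction `ξ`. With `s = ⟨x, ξ⟩ - |ξ|² t` as the
line parameter, `I^{m,m} F = 0` says that pairing `F` with `ξ^I (⟨x, ξ⟩ - s)^m exp(i⟨x, Aξ⟩)` gives
zero for all `ξ ≠ 0` and all `s` (`shiftedPairing_eq_zero`). Comparing powers of `s`, and then
degrees of homogeneity in `ξ` with `η` fixed, separates the orders and the ranks: for `ξ ⟂ η`, each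
`p` and each `j ≤ m`, `∑ ξ^I f_I(⟨x, ξ⟩^j exp(i⟨x, η⟩)) = 0` (`modePairing_eq_zero`).

These are vanishing derivatives of the Fourier transform up to order `m`. For `ξ ⟂ η`, the
polynomial `t ↦ ∑ (ξ + tη)^I f_I(exp(i⟨x, η⟩))` has degree at most `p ≤ m`. Taylor expansion of the
wave about a frequency orthogonal to `ξ + tη` shows that it is `O(t^(m+1))`, so it is zero
(`sum_monomial_line_eq_zero`). Such lines fill a dense set of `ξ` when `n ≥ 2`, so the symmetric
form vanishes, hence so do its components, and Fourier inversion gives `F = 0`. -/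

theorem integral_linearIsometryEquiv_comp {Z V W : Type*} [MeasurableSpace Z] {μ : Measure Z}
    [NormedAddCommGroup V] [NormedSpace ℝ V] [NormedAddCommGroup W] [NormedSpace ℝ W]
    (e : V ≃ₗᵢ[ℝ] W) (f : Z → V) : ∫ z, e (f z) ∂μ = e (∫ z, f z ∂μ) :=
  e.toContinuousLinearEquiv.integral_comp_comm f

/-! ### Differentiation under the integral sign to all orders. -/

section Parametric

variable {E Z : Type*} [NormedAddCommGroup E] [NormedSpace ℝ E]
  [NormedAddCommGroup Z] [NormedSpace ℝ Z]

theorem contDiff_iteratedFDeriv_uncurry {Φ : Z → E → ℂ} (hΦ : ContDiff ℝ ∞ (uncurry Φ)) (j : ℕ) :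
    ContDiff ℝ ∞ (fun q : Z × E => iteratedFDeriv ℝ j (Φ q.1) q.2) := by
  induction j with
  | zero =>
    exact (continuousMultilinearCurryFin0 ℝ E ℂ).symm.contDiff.comp hΦ
  | succ j ih =>
    have h := ContDiff.fderiv (𝕜 := ℝ) (m := ∞) (n := ∞)
      (f := fun (q : Z × E) y => iteratedFDeriv ℝ j (Φ q.1) y) (g := Prod.snd)
      (ih.comp ((contDiff_fst.comp contDiff_fst).prodMk contDiff_snd)) contDiff_snd (by simp)
    simp only [iteratedFDeriv_succ_eq_comp_left, comp_apply]
    exact (continuousMultilinearCurryLeftEquiv ℝ (fun _ : Fin (j + 1) => E) ℂ).symm.contDiff.comp h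

theorem contDiff_of_uncurry {Φ : Z → E → ℂ} (hΦ : ContDiff ℝ ∞ (uncurry Φ)) (z : Z) :
    ContDiff ℝ ∞ (Φ z) :=
  hΦ.comp (contDiff_const.prodMk contDiff_id)

/-- Every `x`-derivative of `Φ` is, locally uniformly in `x`, dominated by an integrable function. -/
def LocallyDominated [MeasurableSpace Z] (Φ : Z → E → ℂ) (μ : Measure Z) : Prop :=
  ∀ (j : ℕ) (R : ℝ), ∃ B : Z → ℝ, Integrable B μ ∧
    ∀ z, ∀ x ∈ Metric.closedBall (0 : E) R, ‖iteratedFDeriv ℝ j (Φ z) x‖ ≤ B z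

variable [MeasurableSpace Z] [BorelSpace Z]

theorem iteratedFDeriv_integral [SecondCountableTopology Z] {Φ : Z → E → ℂ} {μ : Measure Z}
    (hΦ : ContDiff ℝ ∞ (uncurry Φ)) (hB : LocallyDominated Φ μ) (j : ℕ) :
    iteratedFDeriv ℝ j (fun x => ∫ z, Φ z x ∂μ) = fun x => ∫ z, iteratedFDeriv ℝ j (Φ z) x ∂μ := by
  have hint : ∀ (j : ℕ) (x : E), Integrable (fun z => iteratedFDeriv ℝ j (Φ z) x) μ := by
    intro j x
    obtain ⟨B, hBi, hBb⟩ := hB j ‖x‖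
    refine hBi.mono' ?_ (ae_of_all _ fun z => hBb z x (by simp))
    exact ((contDiff_iteratedFDeriv_uncurry hΦ j).continuous.comp
      (Continuous.prodMk_left x)).aestronglyMeasurable
  induction j with
  | zero =>
    funext x
    simp only [iteratedFDeriv_zero_eq_comp, comp_apply]
    exact ((continuousMultilinearCurryFin0 ℝ E ℂ).symm.toContinuousLinearEquiv.integral_comp_comm
      (fun z => Φ z x)).symm
  | succ j ih =>
    funext x
    -- The extra radius makes the ball a neighbourhood of `x` on which the bound is uniform.
    obtain ⟨B, hBi, hBb⟩ := hB (j + 1) (‖x‖ + 1)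
    have key : HasFDerivAt (fun y => ∫ z, iteratedFDeriv ℝ j (Φ z) y ∂μ)
        (∫ z, fderiv ℝ (iteratedFDeriv ℝ j (Φ z)) x ∂μ) x := by
      refine hasFDerivAt_integral_of_dominated_of_fderiv_le (bound := B)
        (F := fun y z => iteratedFDeriv ℝ j (Φ z) y)
        (F' := fun y z => fderiv ℝ (iteratedFDeriv ℝ j (Φ z)) y)
        (s := Metric.ball 0 (‖x‖ + 1))
        (Metric.isOpen_ball.mem_nhds (by simp)) ?_ (hint j x) ?_ ?_ hBi ?_
      · exact Filter.Eventually.of_forall fun y => (hint j y).aestronglyMeasurable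
      · have h := ContDiff.fderiv (𝕜 := ℝ) (m := ∞) (n := ∞)
          (f := fun z y => iteratedFDeriv ℝ j (Φ z) y) (g := fun _ => x)
          (contDiff_iteratedFDeriv_uncurry hΦ j) contDiff_const (by simp)
        exact h.continuous.aestronglyMeasurable
      · refine ae_of_all _ fun z y hy => ?_
        rw [norm_fderiv_iteratedFDeriv]
        exact hBb z y (Metric.ball_subset_closedBall hy)
      · refine ae_of_all _ fun z y _ => DifferentiableAt.hasFDerivAt ?_
        exact ((contDiff_of_uncurry hΦ z).differentiable_iteratedFDeriv (m := j)
          (by exact_mod_cast WithTop.coe_lt_top _)) y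
    rw [iteratedFDeriv_succ_eq_comp_left, comp_apply, ih, key.fderiv]
    simp only [iteratedFDeriv_succ_eq_comp_left, comp_apply]
    exact (integral_linearIsometryEquiv_comp (V := E →L[ℝ] E [×j]→L[ℝ] ℂ)
      (continuousMultilinearCurryLeftEquiv ℝ (fun _ : Fin (j + 1) => E) ℂ).symm
      (fun z => fderiv ℝ (iteratedFDeriv ℝ j (Φ z)) x)).symm

theorem locallyDominated_of_compact [ProperSpace E] {Φ : Z → E → ℂ} {μ : Measure Z}
    [IsFiniteMeasureOnCompacts μ] (hΦ : ContDiff ℝ ∞ (uncurry Φ)) {L : Set Z} (hL : IsCompact L)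
    (h0 : ∀ z ∉ L, Φ z = 0) : LocallyDominated Φ μ := by
  intro j R
  obtain ⟨C, hC⟩ := (hL.prod (isCompact_closedBall (0 : E) R)).exists_bound_of_continuousOn
    (contDiff_iteratedFDeriv_uncurry hΦ j).continuous.continuousOn
  refine ⟨L.indicator fun _ => C, ?_, fun z x hx => ?_⟩
  · exact (integrable_indicator_iff hL.measurableSet).2 (integrableOn_const hL.measure_lt_top.ne)
  · by_cases hz : z ∈ L
    · simpa [hz] using hC (z, x) ⟨hz, hx⟩
    · rw [h0 z hz, Set.indicator_of_notMem hz]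
      simp

end Parametric

/-! ### Compactly supported distributions as functionals on Banach spaces of jets. -/

variable {n : ℕ}

/-- The functional `T` is bounded by finitely many derivatives on the closed ball of radius `R`. -/
def BoundedOnBall (T : SmoothFun n →ₗ[ℂ] ℂ) (R : ℝ) : Prop :=
  ∃ (N : ℕ) (C : ℝ), 0 ≤ C ∧ ∀ (φ : SmoothFun n) (M : ℝ), 0 ≤ M →
    (∀ j ≤ N, ∀ x ∈ Metric.closedBall (0 : Space n) R,
      ‖iteratedFDeriv ℝ j (φ : Space n → ℂ) x‖ ≤ M) → ‖T φ‖ ≤ C * M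

theorem IsContinuousFunctional.eventually_boundedOnBall {T : SmoothFun n →ₗ[ℂ] ℂ}
    (hT : IsContinuousFunctional T) : ∀ᶠ R in Filter.atTop, BoundedOnBall T R := by
  obtain ⟨K, N, C, hK, hC, h⟩ := hT
  obtain ⟨R, hR⟩ := hK.isBounded.subset_closedBall (0 : Space n)
  filter_upwards [Filter.eventually_ge_atTop R] with R' hR'
  exact ⟨N, C, hC, fun φ M hM hφ => h φ M hM fun j hj x hx =>
    hφ j hj x (Metric.closedBall_subset_closedBall hR' (hR hx))⟩

instance compactSpace_closedBall (R : ℝ) : CompactSpace (Metric.closedBall (0 : Space n) R) :=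
  isCompact_iff_compactSpace.1 (isCompact_closedBall _ _)

/-- The Banach space of continuous functions on a closed ball with values in the `j`-linear maps. -/
def JetComponent (n j : ℕ) (R : ℝ) : Type :=
  C(Metric.closedBall (0 : Space n) R, (Space n) [×j]→L[ℝ] ℂ)

instance (j : ℕ) (R : ℝ) : NormedAddCommGroup (JetComponent n j R) :=
  inferInstanceAs (NormedAddCommGroup C(Metric.closedBall (0 : Space n) R, (Space n) [×j]→L[ℝ] ℂ))

instance (j : ℕ) (R : ℝ) : NormedSpace ℂ (JetComponent n j R) :=
  inferInstanceAs (NormedSpace ℂ C(Metric.closedBall (0 : Space n) R, (Space n) [×j]→L[ℝ] ℂ))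

instance (j : ℕ) (R : ℝ) : CompleteSpace (JetComponent n j R) :=
  inferInstanceAs (CompleteSpace C(Metric.closedBall (0 : Space n) R, (Space n) [×j]→L[ℝ] ℂ))

/-- Evaluation of a jet component at a point. -/
def JetComponent.eval {j : ℕ} {R : ℝ} (x : Metric.closedBall (0 : Space n) R) :
    JetComponent n j R →L[ℝ] (Space n) [×j]→L[ℝ] ℂ :=
  LinearMap.mkContinuous
    { toFun := fun f => (show C(Metric.closedBall (0 : Space n) R, (Space n) [×j]→L[ℝ] ℂ) from f) x
      map_add' := fun _ _ => rfl
      map_smul' := fun _ _ => rfl } 1 fun f => by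
    rw [one_mul]
    exact ContinuousMap.norm_coe_le_norm
      (show C(Metric.closedBall (0 : Space n) R, (Space n) [×j]→L[ℝ] ℂ) from f) x

theorem JetComponent.ext {j : ℕ} {R : ℝ} {f g : JetComponent n j R}
    (h : ∀ x, JetComponent.eval x f = JetComponent.eval x g) : f = g :=
  ContinuousMap.ext h

theorem JetComponent.norm_le {j : ℕ} {R C : ℝ} (hC : 0 ≤ C) {f : JetComponent n j R} :
    ‖f‖ ≤ C ↔ ∀ x, ‖JetComponent.eval x f‖ ≤ C :=
  ContinuousMap.norm_le (α := Metric.closedBall (0 : Space n) R) f hC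

/-- The Banach space of jets of order `N` on the closed ball of radius `R`. -/
abbrev JetSpace (n N : ℕ) (R : ℝ) : Type := (j : Fin (N + 1)) → JetComponent n j R

/-- The jet of order `N` of a smooth function on a closed ball. -/
def jet (N : ℕ) (R : ℝ) : SmoothFun n →ₗ[ℂ] JetSpace n N R where
  toFun φ j := (⟨fun x => iteratedFDeriv ℝ j (φ : Space n → ℂ) x,
    (ContDiff.continuous_iteratedFDeriv (n := ∞) (by exact_mod_cast le_top) φ.2).comp
      continuous_subtype_val⟩ :
        C(Metric.closedBall (0 : Space n) R, (Space n) [×(j : ℕ)]→L[ℝ] ℂ))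
  map_add' φ ψ := by
    have hφ : ContDiff ℝ ∞ (φ : Space n → ℂ) := φ.2
    have hψ : ContDiff ℝ ∞ (ψ : Space n → ℂ) := ψ.2
    funext j
    refine JetComponent.ext fun x => ?_
    exact iteratedFDeriv_add_apply (hφ.contDiffAt.of_le (by exact_mod_cast le_top))
      (hψ.contDiffAt.of_le (by exact_mod_cast le_top))
  map_smul' c φ := by
    have hφ : ContDiff ℝ ∞ (φ : Space n → ℂ) := φ.2
    funext j
    refine JetComponent.ext fun x => ?_
    exact iteratedFDeriv_const_smul_apply (hφ.contDiffAt.of_le (by exact_mod_cast le_top))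

theorem eval_jet {N : ℕ} {R : ℝ} (φ : SmoothFun n) (j : Fin (N + 1))
    (x : Metric.closedBall (0 : Space n) R) :
    JetComponent.eval x (jet N R φ j) = iteratedFDeriv ℝ j (φ : Space n → ℂ) x :=
  rfl

/-- The bound makes `T` depend only on the jet, so `T` descends to the range of `jet`, and
Hahn–Banach extends it to the Banach space. Continuity and Bochner integration then pass through
`T`. -/
theorem BoundedOnBall.exists_jet_functional {T : SmoothFun n →ₗ[ℂ] ℂ} {R : ℝ}
    (hT : BoundedOnBall T R) :
    ∃ (N : ℕ) (l : JetSpace n N R →L[ℂ] ℂ), ∀ φ, l (jet N R φ) = T φ := by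
  obtain ⟨N, C, hC, h⟩ := hT
  have hb : ∀ φ, ‖T φ‖ ≤ C * ‖jet N R φ‖ := by
    intro φ
    refine h φ _ (norm_nonneg _) fun j hj x hx => ?_
    have h1 := norm_le_pi_norm (jet N R φ) ⟨j, Nat.lt_succ_of_le hj⟩
    exact (JetComponent.norm_le (norm_nonneg _)).1 h1 ⟨x, hx⟩
  -- The algebraic section `s` need not be continuous; `T ∘ s` is, because `T` is controlled by the
  -- jet alone.
  obtain ⟨s, hs⟩ := (jet (n := n) N R).rangeRestrict.exists_rightInverse_of_surjective
    (LinearMap.range_rangeRestrict _)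
  have hs' : ∀ v, (jet (n := n) N R) (s v) = v := fun v =>
    congrArg Subtype.val (LinearMap.congr_fun hs v)
  obtain ⟨l, hl, -⟩ := exists_extension_norm_eq (𝕜 := ℂ) (jet (n := n) N R).range
    ((T ∘ₗ s).mkContinuous C fun v => by
      have := hb (s v)
      rwa [hs'] at this)
  refine ⟨N, l, fun φ => ?_⟩
  have h1 := hl ⟨jet N R φ, LinearMap.mem_range_self _ _⟩
  rw [h1]
  -- The two functions have the same jet, so `T` does not distinguish them.
  have h2 := hb (s ⟨jet N R φ, LinearMap.mem_range_self _ _⟩ - φ)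
  rw [map_sub, map_sub, hs', sub_self, norm_zero, mul_zero] at h2
  exact sub_eq_zero.1 (norm_le_zero_iff.1 h2)

/-! ### Pairing a distribution with a smooth family. -/

section Family

variable {Z : Type*} [NormedAddCommGroup Z] [NormedSpace ℝ Z]

/-- The member at `z` of a jointly smooth family. -/
def member {Φ : Z → Space n → ℂ} (hΦ : ContDiff ℝ ∞ (uncurry Φ)) (z : Z) : SmoothFun n :=
  ⟨Φ z, contDiff_of_uncurry hΦ z⟩

theorem continuous_jet_member {Φ : Z → Space n → ℂ} (hΦ : ContDiff ℝ ∞ (uncurry Φ)) (N : ℕ)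
    (R : ℝ) (j : Fin (N + 1)) : Continuous fun z => jet N R (member hΦ z) j :=
  (ContinuousMap.curry ⟨fun q : Z × Metric.closedBall (0 : Space n) R =>
    iteratedFDeriv ℝ j (Φ q.1) q.2, (contDiff_iteratedFDeriv_uncurry hΦ j).continuous.comp
      (continuous_fst.prodMk (continuous_subtype_val.comp continuous_snd))⟩).continuous

theorem BoundedOnBall.continuous_apply_member {T : SmoothFun n →ₗ[ℂ] ℂ} {R : ℝ}
    (hT : BoundedOnBall T R) {Φ : Z → Space n → ℂ} (hΦ : ContDiff ℝ ∞ (uncurry Φ)) :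
    Continuous fun z => T (member hΦ z) := by
  obtain ⟨N, l, hl⟩ := hT.exists_jet_functional
  simp only [← hl]
  exact l.continuous.comp (continuous_pi fun j => continuous_jet_member hΦ N R j)

variable [MeasurableSpace Z] [BorelSpace Z] [SecondCountableTopology Z]

/-- A functional bounded on a ball commutes with the integral of a smooth family. -/
theorem BoundedOnBall.apply_eq_integral {T : SmoothFun n →ₗ[ℂ] ℂ} {R : ℝ}
    (hT : BoundedOnBall T R) {Φ : Z → Space n → ℂ} (hΦ : ContDiff ℝ ∞ (uncurry Φ))
    {μ : Measure Z} (hB : LocallyDominated Φ μ) (φ : SmoothFun n)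
    (hφ : ∀ x ∈ Metric.ball (0 : Space n) (R + 1), (φ : Space n → ℂ) x = ∫ z, Φ z x ∂μ) :
    Integrable (fun z => T (member hΦ z)) μ ∧ T φ = ∫ z, T (member hΦ z) ∂μ := by
  obtain ⟨N, l, hl⟩ := hT.exists_jet_functional
  have hint : ∀ j, Integrable (fun z => jet N R (member hΦ z) j) μ := by
    intro j
    obtain ⟨B, hBi, hBb⟩ := hB j R
    refine hBi.norm.mono' (continuous_jet_member hΦ N R j).aestronglyMeasurable
      (ae_of_all _ fun z => ?_)
    exact (JetComponent.norm_le (norm_nonneg _)).2 fun x => (hBb z x x.2).trans (le_abs_self _)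
  have hint' : Integrable (fun z => jet N R (member hΦ z)) μ := Integrable.of_eval hint
  have hjet : jet N R φ = ∫ z, jet N R (member hΦ z) ∂μ := by
    funext j
    refine JetComponent.ext fun x => ?_
    have h1 : (∫ z, jet N R (member hΦ z) ∂μ) j = ∫ z, jet N R (member hΦ z) j ∂μ :=
      ((ContinuousLinearMap.proj (R := ℝ) (φ := fun j : Fin (N + 1) =>
        JetComponent n j R) j).integral_comp_comm hint').symm
    rw [h1, ← (JetComponent.eval x).integral_comp_comm (hint j)]
    simp only [eval_jet]
    -- Agreement on the open ball of radius `R + 1` gives equal derivatives even at boundary points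
    -- of the closed ball.
    have h2 : (φ : Space n → ℂ) =ᶠ[nhds (x : Space n)] fun x => ∫ z, Φ z x ∂μ := by
      filter_upwards [Metric.isOpen_ball.mem_nhds
        (Metric.closedBall_subset_ball (lt_add_one R) x.2)] with y hy using hφ y hy
    have h3 := (h2.iteratedFDeriv ℝ j).eq_of_nhds
    rw [iteratedFDeriv_integral hΦ hB] at h3
    exact h3
  simp only [← hl]
  exact ⟨l.integrable_comp hint', by rw [hjet, l.integral_comp_comm hint']⟩

end Family

/-! ### Plane waves and Fourier inversion. -/

theorem contDiff_inner_ofReal {E : Type*} [NormedAddCommGroup E] [NormedSpace ℝ E]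
    {f g : E → Space n} (hf : ContDiff ℝ ∞ f) (hg : ContDiff ℝ ∞ g) :
    ContDiff ℝ ∞ fun e => ((inner ℝ (f e) (g e) : ℝ) : ℂ) :=
  Complex.ofRealCLM.contDiff.comp (hf.inner ℝ hg)

theorem contDiff_exp_inner {E : Type*} [NormedAddCommGroup E] [NormedSpace ℝ E]
    {f g : E → Space n} (hf : ContDiff ℝ ∞ f) (hg : ContDiff ℝ ∞ g) :
    ContDiff ℝ ∞ fun e => Complex.exp (((inner ℝ (f e) (g e) : ℝ) : ℂ) * Complex.I) :=
  ((contDiff_inner_ofReal hf hg).mul contDiff_const).cexp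

/-- The plane wave `x ↦ exp (i ⟨x, η⟩)`. -/
def wave (η : Space n) : SmoothFun n :=
  ⟨fun x => Complex.exp (((inner ℝ x η : ℝ) : ℂ) * Complex.I),
    contDiff_exp_inner contDiff_id contDiff_const⟩

theorem iteratedDeriv_exp_mul_I (j : ℕ) :
    iteratedDeriv j (fun t : ℝ => Complex.exp ((t : ℂ) * Complex.I)) =
      fun t : ℝ => Complex.I ^ j * Complex.exp ((t : ℂ) * Complex.I) := by
  induction j with
  | zero => simp
  | succ j ih =>
    funext t
    rw [iteratedDeriv_succ, ih]
    have h := (((Complex.ofRealCLM.hasDerivAt (x := t)).mul_const Complex.I).cexp).const_mul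
      (Complex.I ^ j)
    refine h.deriv.trans ?_
    simp only [Complex.ofRealCLM_apply, Complex.ofReal_one, one_mul]
    ring

/-- This polynomial growth in `η` is what the decay of a Schwartz function absorbs in the inversion
integral. -/
theorem norm_iteratedFDeriv_wave_le (η : Space n) (j : ℕ) (x : Space n) :
    ‖iteratedFDeriv ℝ j (wave η : Space n → ℂ) x‖ ≤ ‖η‖ ^ j := by
  have hexp : ContDiff ℝ ∞ (fun t : ℝ => Complex.exp ((t : ℂ) * Complex.I)) :=
    (Complex.ofRealCLM.contDiff.mul contDiff_const).cexp
  have h : (wave η : Space n → ℂ) =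
      (fun t : ℝ => Complex.exp ((t : ℂ) * Complex.I)) ∘ (innerSL ℝ η) := by
    funext x
    simp [wave, real_inner_comm]
  rw [h, ContinuousLinearMap.iteratedFDeriv_comp_right _ hexp x
    (by exact_mod_cast le_top : (j : WithTop ℕ∞) ≤ ∞)]
  refine (ContinuousMultilinearMap.norm_compContinuousLinearMap_le _ _).trans ?_
  rw [norm_iteratedFDeriv_eq_norm_iteratedDeriv, iteratedDeriv_exp_mul_I]
  simp [Complex.norm_exp_ofReal_mul_I]

open scoped FourierTransform SchwartzMap in
/-- A compactly supported distribution whose Fourier transform vanishes is zero. -/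
theorem BoundedOnBall.eq_zero_of_wave {T : SmoothFun n →ₗ[ℂ] ℂ} {R : ℝ} (hT : BoundedOnBall T R)
    (h : ∀ η, T (wave η) = 0) : T = 0 := by
  ext φ
  have hφ : ContDiff ℝ ∞ (φ : Space n → ℂ) := φ.2
  -- The cutoff equals one on the ball of radius `R + 1`, where `T` can see; the absolute value
  -- covers negative `R`.
  let χ : ContDiffBump (0 : Space n) := ⟨|R| + 1, |R| + 2, by positivity, by linarith⟩
  have hg : ContDiff ℝ ∞ fun x => (χ x : ℂ) * (φ : Space n → ℂ) x :=
    (Complex.ofRealCLM.contDiff.comp χ.contDiff).mul hφ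
  have hgc : HasCompactSupport fun x => (χ x : ℂ) * (φ : Space n → ℂ) x :=
    (χ.hasCompactSupport.comp_left (g := fun t : ℝ => (t : ℂ)) (by simp)).mul_right
  let S : 𝓢(Space n, ℂ) := hgc.toSchwartzMap hg
  -- The integrand of Fourier inversion; `2π` converts from the normalisation `exp(2πi⟨x, η⟩)`.
  let Φ : Space n → Space n → ℂ := fun η x => 𝓕 S η * (wave ((2 * Real.pi) • η) : Space n → ℂ) x
  have hΦ : ContDiff ℝ ∞ (uncurry Φ) := by
    refine (((𝓕 S).smooth ⊤).comp contDiff_fst).mul ?_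
    exact contDiff_exp_inner contDiff_snd (contDiff_fst.const_smul (2 * Real.pi))
  have hmem : ∀ η, member hΦ η = 𝓕 S η • wave ((2 * Real.pi) • η) := fun η => rfl
  have hB : LocallyDominated Φ volume := by
    intro j r
    refine ⟨fun η => (2 * Real.pi) ^ j * (‖η‖ ^ j * ‖𝓕 S η‖),
      ((𝓕 S).integrable_pow_mul volume j).const_mul _, fun η x _ => ?_⟩
    have hw : ContDiff ℝ ∞ (wave ((2 * Real.pi) • η) : Space n → ℂ) := (wave _).2
    have h1 : iteratedFDeriv ℝ j (Φ η) x =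
        𝓕 S η • iteratedFDeriv ℝ j (wave ((2 * Real.pi) • η) : Space n → ℂ) x :=
      iteratedFDeriv_const_smul_apply (a := 𝓕 S η) (hw.contDiffAt.of_le (by exact_mod_cast le_top))
    rw [h1, norm_smul]
    calc _ ≤ ‖𝓕 S η‖ * ‖(2 * Real.pi) • η‖ ^ j := by
          gcongr
          exact norm_iteratedFDeriv_wave_le _ _ _
      _ = _ := by
          rw [norm_smul, mul_pow, Real.norm_of_nonneg (by positivity)]
          ring
  have key := (hT.apply_eq_integral hΦ hB φ fun x hx => ?_).2
  · rw [key]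
    simp [hmem, h]
  · have hx' : χ x = 1 := by
      refine χ.one_of_mem_closedBall ?_
      rw [mem_ball_zero_iff] at hx
      rw [mem_closedBall_zero_iff]
      exact hx.le.trans (by linarith [le_abs_self R])
    have hS : (φ : Space n → ℂ) x = S x := by
      change _ = (χ x : ℂ) * (φ : Space n → ℂ) x
      simp [hx']
    have hinv : S x = 𝓕⁻ (𝓕 S) x := by rw [FourierPair.fourierInv_fourier_eq]
    rw [hS, hinv, SchwartzMap.fourierInv_coe, Real.fourierInv_eq']
    refine integral_congr_ae (ae_of_all _ fun η => ?_)
    simp only [Φ, wave, inner_smul_right, smul_eq_mul]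
    rw [mul_comm, real_inner_comm]

/-! ### Plane-wave test functions and the adjoint transform. -/

/-- The function `x ↦ ⟨x, ξ⟩ ^ j * exp (i ⟨x, η⟩)`. -/
def mode (j : ℕ) (ξ η : Space n) : SmoothFun n :=
  ⟨fun x => ((inner ℝ x ξ : ℝ) : ℂ) ^ j * (wave η : Space n → ℂ) x,
    ((contDiff_inner_ofReal contDiff_id contDiff_const).pow j).mul
      (contDiff_exp_inner contDiff_id contDiff_const)⟩

theorem mode_smul (j : ℕ) (r : ℝ) (ξ η : Space n) : mode j (r • ξ) η = (r : ℂ) ^ j • mode j ξ η := by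
  refine Subtype.ext (funext fun x => ?_)
  simp [mode, inner_smul_right, mul_pow, mul_assoc]

/-- The monomial `ξ^{i₁} ⋯ ξ^{i_p}`. -/
def monomial {p : ℕ} (i : Fin p → Fin n) (ξ : Space n) : ℂ := ((∏ k, ξ (i k) : ℝ) : ℂ)

theorem contDiff_monomial {p : ℕ} (i : Fin p → Fin n) : ContDiff ℝ ∞ (monomial i) :=
  Complex.ofRealCLM.contDiff.comp (contDiff_prod (t := Finset.univ) fun k _ =>
    (EuclideanSpace.proj (i k) : Space n →L[ℝ] ℝ).contDiff)

theorem monomial_smul {p : ℕ} (i : Fin p → Fin n) (r : ℝ) (ξ : Space n) :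
    monomial i (r • ξ) = (r : ℂ) ^ p * monomial i ξ := by
  simp [monomial, Finset.prod_mul_distrib]

theorem coeff_eq_zero_of_forall_ne_zero {N : ℕ} {c : ℕ → ℂ}
    (h : ∀ r : ℝ, r ≠ 0 → ∑ k ∈ Finset.range N, (r : ℂ) ^ k * c k = 0) :
    ∀ k < N, c k = 0 := by
  let P : Polynomial ℂ := ∑ k ∈ Finset.range N, Polynomial.monomial k (c k)
  have hP : P = 0 := by
    refine Polynomial.eq_zero_of_infinite_isRoot P ?_
    refine Set.Infinite.mono (s := (fun r : ℝ => (r : ℂ)) '' {0}ᶜ) ?_ ?_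
    · rintro _ ⟨r, hr, rfl⟩
      simp only [Set.mem_ofPred_eq, Polynomial.IsRoot, P, Polynomial.eval_finsetSum,
        Polynomial.eval_monomial]
      rw [← h r hr]
      exact Finset.sum_congr rfl fun k _ => mul_comm _ _
    · exact (Set.finite_singleton (0 : ℝ)).infinite_compl.image Complex.ofReal_injective.injOn
  intro k hk
  have := congrArg (fun Q => Polynomial.coeff Q k) hP
  simpa [P, Polynomial.finsetSum_coeff, Polynomial.coeff_monomial, hk] using this

/-- The family `x ↦ ξ^{i₁} ⋯ ξ^{i_p} (⟨x, ξ⟩ - s) ^ m exp (i ⟨x, A ξ⟩)` indexed by `(ξ, s)`. -/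
def shiftedFamily {p : ℕ} (m : ℕ) (i : Fin p → Fin n) (A : Space n →L[ℝ] Space n)
    (z : Space n × ℝ) (x : Space n) : ℂ :=
  monomial i z.1 * (((inner ℝ x z.1 : ℝ) : ℂ) - (z.2 : ℂ)) ^ m *
    Complex.exp (((inner ℝ x (A z.1) : ℝ) : ℂ) * Complex.I)

theorem contDiff_shiftedFamily {p : ℕ} (m : ℕ) (i : Fin p → Fin n)
    (A : Space n →L[ℝ] Space n) : ContDiff ℝ ∞ (uncurry (shiftedFamily m i A)) := by
  refine (ContDiff.mul ((contDiff_monomial i).comp (contDiff_fst.comp contDiff_fst))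
    (ContDiff.pow (ContDiff.sub ?_ ?_) m)).mul ?_
  · exact contDiff_inner_ofReal contDiff_snd (contDiff_fst.comp contDiff_fst)
  · exact Complex.ofRealCLM.contDiff.comp (contDiff_snd.comp contDiff_fst)
  · exact contDiff_exp_inner contDiff_snd (A.contDiff.comp (contDiff_fst.comp contDiff_fst))

/-- The test function `χ(y) w(ξ, ⟨y, ξ⟩) |ξ|^{2m+2} exp (i ⟨y, A ξ⟩)`. -/
def waveTest (m : ℕ) (A : Space n →L[ℝ] Space n) (χ : ContDiffBump (0 : Space n))
    {w : Space n × ℝ → ℝ} (hw : ContDiff ℝ ∞ w) (hwc : HasCompactSupport w)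
    (hwU : tsupport w ⊆ {z | z.1 ≠ 0}) : PhaseTest n where
  -- The power of `|ξ|²` is what `t^m dt` needs to become `(⟨x, ξ⟩ - s)^m ds`: `m` factors for `t^m`
  -- and one for the Jacobian.
  toFun q := ((χ q.1 * w (q.2, inner ℝ q.1 q.2) * (‖q.2‖ ^ 2) ^ (m + 1) : ℝ) : ℂ) *
    Complex.exp (((inner ℝ q.1 (A q.2) : ℝ) : ℂ) * Complex.I)
  contDiff' := by
    refine ContDiff.mul (Complex.ofRealCLM.contDiff.comp ((ContDiff.mul ?_ ?_).mul ?_)) ?_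
    · exact χ.contDiff.comp contDiff_fst
    · exact hw.comp (contDiff_snd.prodMk (contDiff_fst.inner ℝ contDiff_snd))
    · exact (contDiff_snd.norm_sq ℝ).pow _
    · exact contDiff_exp_inner contDiff_fst (A.contDiff.comp contDiff_snd)
  hasCompactSupport' := by
    refine HasCompactSupport.intro (K := Metric.closedBall 0 χ.rOut ×ˢ (Prod.fst '' tsupport w))
      ((isCompact_closedBall _ _).prod (hwc.image continuous_fst)) fun q hq => ?_
    by_contra hne
    refine hq ⟨?_, ⟨(q.2, inner ℝ q.1 q.2), subset_tsupport _ fun h => hne (by simp [h]), rfl⟩⟩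
    rw [← χ.tsupport_eq]
    exact subset_tsupport _ fun h => hne (by simp [h])
  tsupport_subset' := by
    have hcl : IsClosed (Set.univ ×ˢ (Prod.fst '' tsupport w) : Set (Space n × Space n)) :=
      isClosed_univ.prod (hwc.image continuous_fst).isClosed
    refine (closure_minimal (fun q hq => ?_) hcl).trans ?_
    · exact ⟨trivial, ⟨(q.2, inner ℝ q.1 q.2), subset_tsupport _ fun h => hq (by simp [h]), rfl⟩⟩
    · rintro q ⟨-, z, hz, hzq⟩
      have := hwU hz
      rw [Set.mem_ofPred_eq, hzq] at this
      exact this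

theorem waveTest_apply (m : ℕ) (A : Space n →L[ℝ] Space n) (χ : ContDiffBump (0 : Space n))
    {w : Space n × ℝ → ℝ} (hw : ContDiff ℝ ∞ w) (hwc : HasCompactSupport w)
    (hwU : tsupport w ⊆ {z | z.1 ≠ 0}) (q : Space n × Space n) :
    waveTest m A χ hw hwc hwU q =
      ((χ q.1 * w (q.2, inner ℝ q.1 q.2) * (‖q.2‖ ^ 2) ^ (m + 1) : ℝ) : ℂ) *
        Complex.exp (((inner ℝ q.1 (A q.2) : ℝ) : ℂ) * Complex.I) :=
  rfl

theorem integral_comp_sub_mul_left (h : ℝ → ℂ) (a : ℝ) {b : ℝ} (hb : 0 < b) :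
    ∫ t : ℝ, (b : ℂ) * h (a - b * t) = ∫ s, h s := by
  rw [integral_const_mul, Measure.integral_comp_mul_left (fun s => h (a - s)) b,
    integral_sub_left_eq_self h volume a, abs_of_pos (inv_pos.2 hb), Complex.real_smul,
    ← mul_assoc, ← Complex.ofReal_mul, mul_inv_cancel₀ hb.ne', Complex.ofReal_one, one_mul]

/-- Substitute `s = ⟨x, ξ⟩ - |ξ|² t` in the inner integral. Skewness of `A` removes `t` from the
phase, and the condition on `χ.rIn` makes the cutoff invisible. -/
theorem adjointFun_waveTest {p : ℕ} (m : ℕ) (i : Fin p → Fin n) {A : Space n →L[ℝ] Space n}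
    (hA : ∀ v, inner ℝ v (A v) = 0) {χ : ContDiffBump (0 : Space n)}
    {w : Space n × ℝ → ℝ} (hw : ContDiff ℝ ∞ w) (hwc : HasCompactSupport w)
    (hwU : tsupport w ⊆ {z | z.1 ≠ 0}) {r : ℝ} (hr : ∀ z ∈ tsupport w, |z.2| ≤ r * ‖z.1‖)
    {x : Space n} (hx : 2 * ‖x‖ + r ≤ χ.rIn) :
    adjointFun m i (waveTest m A χ hw hwc hwU) x = ∫ z, (w z : ℂ) * shiftedFamily m i A z x := by
  have hfam : Continuous fun z : Space n × ℝ => shiftedFamily m i A z x :=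
    Continuous.uncurry_right x (contDiff_shiftedFamily m i A).continuous
  have hcont : Continuous fun z : Space n × ℝ => (w z : ℂ) * shiftedFamily m i A z x :=
    (Complex.continuous_ofReal.comp hw.continuous).mul hfam
  have hcs : HasCompactSupport fun z : Space n × ℝ => (w z : ℂ) * shiftedFamily m i A z x :=
    HasCompactSupport.intro hwc fun z hz => by simp [image_eq_zero_of_notMem_tsupport hz]
  have hint : Integrable (fun z : Space n × ℝ => (w z : ℂ) * shiftedFamily m i A z x) :=
    hcont.integrable_of_hasCompactSupport hcs
  rw [adjointFun, Measure.volume_eq_prod, integral_prod _ hint]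
  refine integral_congr_ae (ae_of_all _ fun ξ => ?_)
  by_cases hξ : ξ = 0
  · have hw0 : ∀ s, w (ξ, s) = 0 := fun s => by
      by_contra hne
      exact hwU (subset_tsupport _ hne) hξ
    simp [adjointIntegrand, waveTest_apply, hw0]
  have hpos : 0 < ‖ξ‖ := norm_pos_iff.2 hξ
  simp only
  rw [← integral_comp_sub_mul_left (fun s => (w (ξ, s) : ℂ) * shiftedFamily m i A (ξ, s) x)
    (inner ℝ x ξ) (pow_pos hpos 2)]
  refine integral_congr_ae (ae_of_all _ fun t => ?_)
  have h1 : inner ℝ (x - t • ξ) ξ = inner ℝ x ξ - ‖ξ‖ ^ 2 * t := by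
    rw [inner_sub_left, real_inner_smul_left, real_inner_self_eq_norm_sq, mul_comm]
  have h2 : inner ℝ (x - t • ξ) (A ξ) = inner ℝ x (A ξ) := by
    rw [inner_sub_left, real_inner_smul_left, hA, mul_zero, sub_zero]
  simp only [adjointIntegrand, waveTest_apply, shiftedFamily, monomial, h1, h2]
  by_cases hws : w (ξ, inner ℝ x ξ - ‖ξ‖ ^ 2 * t) = 0
  · simp [hws]
  have h3 : |inner ℝ x ξ - ‖ξ‖ ^ 2 * t| ≤ r * ‖ξ‖ := hr _ (subset_tsupport _ hws)
  -- On the support of `w` the displacement `tξ` is bounded, as `|ξ|² t = ⟨x, ξ⟩ - s` with `|s| ≤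
  -- r|ξ|`.
  have h4 : |t| * ‖ξ‖ ≤ ‖x‖ + r := by
    refine le_of_mul_le_mul_right ?_ hpos
    calc |t| * ‖ξ‖ * ‖ξ‖ = |inner ℝ x ξ - (inner ℝ x ξ - ‖ξ‖ ^ 2 * t)| := by
          rw [sub_sub_cancel, abs_mul, abs_of_nonneg (sq_nonneg ‖ξ‖)]
          ring
      _ ≤ |inner ℝ x ξ| + |inner ℝ x ξ - ‖ξ‖ ^ 2 * t| := abs_sub _ _
      _ ≤ ‖x‖ * ‖ξ‖ + r * ‖ξ‖ := add_le_add (abs_real_inner_le_norm _ _) h3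
      _ = (‖x‖ + r) * ‖ξ‖ := by ring
  have h5 : χ (x - t • ξ) = 1 := by
    refine χ.one_of_mem_closedBall (mem_closedBall_zero_iff.2 ?_)
    calc ‖x - t • ξ‖ ≤ ‖x‖ + |t| * ‖ξ‖ := by
          simpa [norm_smul] using norm_sub_le x (t • ξ)
      _ ≤ χ.rIn := by linarith
  rw [h5]
  push_cast
  ring

/-- The functional `f ↦ ∑ f_{i₁…i_p}(Φ_{i₁…i_p})` evaluated at the shifted family. -/
def shiftedPairing {m : ℕ} (F : MixedTensorDistribution n m) (A : Space n →L[ℝ] Space n)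
    (z : Space n × ℝ) : ℂ :=
  ∑ p, ∑ i, ((F p).1 i).1 (member (contDiff_shiftedFamily m i A) z)

theorem exists_boundedOnBall {m : ℕ} (F : MixedTensorDistribution n m) :
    ∃ R : ℝ, ∀ p i, BoundedOnBall ((F p).1 i).1 R := by
  have h : ∀ᶠ R in Filter.atTop, ∀ p i, BoundedOnBall ((F p).1 i).1 R := by
    rw [Filter.eventually_all]
    intro p
    rw [Filter.eventually_all]
    intro i
    exact IsContinuousFunctional.eventually_boundedOnBall ((F p).1 i).2
  exact h.exists

/-- The weight `w` is arbitrary, so the fundamental lemma of the calculus of variations gives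
vanishing almost everywhere off `ξ = 0`, and continuity gives it everywhere there. -/
theorem shiftedPairing_eq_zero {m : ℕ} {F : MixedTensorDistribution n m} (hF : MRT m F = 0)
    {A : Space n →L[ℝ] Space n} (hA : ∀ v, inner ℝ v (A v) = 0) {z : Space n × ℝ}
    (hz : z.1 ≠ 0) : shiftedPairing F A z = 0 := by
  obtain ⟨R, hR⟩ := exists_boundedOnBall F
  have hcont : Continuous (shiftedPairing F A) :=
    continuous_finsetSum _ fun p _ => continuous_finsetSum _ fun i _ =>
      (hR p i).continuous_apply_member _
  have hU : IsOpen {z : Space n × ℝ | z.1 ≠ 0} := isOpen_ne_fun continuous_fst continuous_const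
  have key := hU.ae_eq_zero_of_integral_contDiff_smul_eq_zero (μ := volume)
    (f := shiftedPairing F A) (hcont.locallyIntegrable.locallyIntegrableOn _) ?_
  · have h1 : shiftedPairing F A =ᵐ[volume.restrict {z : Space n × ℝ | z.1 ≠ 0}] 0 :=
      (ae_restrict_iff' hU.measurableSet).2 key
    exact Measure.eqOn_open_of_ae_eq h1 hU hcont.continuousOn continuousOn_const hz
  intro w hw hwc hwU
  -- The quotient `|s|/|ξ|` is the distance from the origin to the hyperplane `⟨y, ξ⟩ = s`; it is
  -- bounded because `ξ ≠ 0` on the compact support of `w`.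
  obtain ⟨r, hr⟩ := hwc.exists_bound_of_continuousOn
    (f := fun z : Space n × ℝ => z.2 / ‖z.1‖) (continuous_snd.continuousOn.div
      continuous_fst.norm.continuousOn fun z hz => norm_ne_zero_iff.2 (hwU hz))
  have hr' : ∀ z ∈ tsupport w, |z.2| ≤ r * ‖z.1‖ := fun z hz => by
    have h := hr z hz
    rwa [norm_div, norm_norm, div_le_iff₀ (norm_pos_iff.2 (hwU hz))] at h
  let χ : ContDiffBump (0 : Space n) :=
    ⟨2 * |R + 1| + |r| + 1, 2 * |R + 1| + |r| + 2, by positivity, by linarith⟩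
  have happly : ∀ p i, Integrable (fun z => ((F p).1 i).1
        (member (contDiff_shiftedFamily m i A) z) * (w z : ℂ)) ∧
      ((F p).1 i).1 (adjoint m i (waveTest m A χ hw hwc hwU)) =
        ∫ z, ((F p).1 i).1 (member (contDiff_shiftedFamily m i A) z) * (w z : ℂ) := by
    intro p i
    have hΦ : ContDiff ℝ ∞ (uncurry fun (z : Space n × ℝ) x =>
        (w z : ℂ) * shiftedFamily m i A z x) :=
      ((Complex.ofRealCLM.contDiff.comp hw).comp contDiff_fst).mul (contDiff_shiftedFamily m i A)
    have hmem : ∀ z, member hΦ z = (w z : ℂ) • member (contDiff_shiftedFamily m i A) z :=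
      fun z => rfl
    have h := (hR p i).apply_eq_integral hΦ (μ := volume)
      (locallyDominated_of_compact hΦ hwc fun z hz => funext fun x => by
        simp [image_eq_zero_of_notMem_tsupport hz])
      (adjoint m i (waveTest m A χ hw hwc hwU)) fun x hx => by
        refine adjointFun_waveTest m i hA hw hwc hwU hr' ?_
        rw [mem_ball_zero_iff] at hx
        change _ ≤ 2 * |R + 1| + |r| + 1
        linarith [le_abs_self (R + 1), le_abs_self r]
    simpa only [hmem, map_smul, smul_eq_mul, mul_comm] using h
  have hMRT := LinearMap.congr_fun hF (waveTest m A χ hw hwc hwU)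
  simp only [MRT, tensorMRT, LinearMap.sum_apply, LinearMap.comp_apply, LinearMap.zero_apply,
    (happly _ _).2] at hMRT
  rw [← hMRT]
  simp only [shiftedPairing, Complex.real_smul, Finset.mul_sum]
  rw [integral_finsetSum _ fun p _ => integrable_finsetSum _ fun i _ => by
    simpa only [mul_comm] using (happly p i).1]
  refine Finset.sum_congr rfl fun p _ => ?_
  rw [integral_finsetSum _ fun i _ => by simpa only [mul_comm] using (happly p i).1]
  simp only [mul_comm]

/-! ### Separating orders and ranks. -/

/-- The pairing `∑ ξ^{i₁} ⋯ ξ^{i_p} f_{i₁…i_p}(⟨x, ξ⟩ ^ j exp (i ⟨x, η⟩))`. -/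
def modePairing {p : ℕ} (f : SymTensorDistribution n p) (j : ℕ) (ξ η : Space n) : ℂ :=
  ∑ i, monomial i ξ * (f.1 i).1 (mode j ξ η)

theorem member_shiftedFamily {p : ℕ} (m : ℕ) (i : Fin p → Fin n) (A : Space n →L[ℝ] Space n)
    (ξ : Space n) (s : ℝ) :
    member (contDiff_shiftedFamily m i A) (ξ, s) = ∑ k ∈ Finset.range (m + 1),
      ((s : ℂ) ^ k * ((-1) ^ k * m.choose k * monomial i ξ)) • mode (m - k) ξ (A ξ) := by
  refine Subtype.ext (funext fun x => ?_)
  rw [AddSubmonoidClass.coe_finsetSum, Finset.sum_apply]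
  simp only [member, shiftedFamily, mode, wave, Submodule.coe_smul, Pi.smul_apply, smul_eq_mul]
  rw [sub_eq_neg_add, add_pow, Finset.mul_sum, Finset.sum_mul]
  refine Finset.sum_congr rfl fun k _ => ?_
  rw [neg_pow]
  ring

theorem shiftedPairing_eq_sum {m : ℕ} (F : MixedTensorDistribution n m)
    (A : Space n →L[ℝ] Space n) (ξ : Space n) (s : ℝ) :
    shiftedPairing F A (ξ, s) = ∑ k ∈ Finset.range (m + 1),
      (s : ℂ) ^ k * ((-1) ^ k * m.choose k * ∑ p, modePairing (F p) (m - k) ξ (A ξ)) := by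
  simp only [shiftedPairing, member_shiftedFamily, map_sum, map_smul, smul_eq_mul, modePairing,
    Finset.mul_sum]
  rw [Finset.sum_comm]
  simp only [mul_assoc]
  rw [Finset.sum_comm]
  conv_rhs => rw [Finset.sum_comm]
  exact Finset.sum_congr rfl fun p _ => Finset.sum_comm

/-- The rank-two rotation generator `(ξ ⊗ η - η ⊗ ξ)/|ξ|²`; it reaches every orthogonal pair with a
phase depending linearly on `ξ`. -/
theorem exists_skew_apply_eq {ξ η : Space n} (hξ : ξ ≠ 0) (h : inner ℝ ξ η = 0) :
    ∃ A : Space n →L[ℝ] Space n, (∀ v, inner ℝ v (A v) = 0) ∧ A ξ = η := by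
  refine ⟨(‖ξ‖ ^ 2)⁻¹ • ((innerSL ℝ ξ).smulRight η - (innerSL ℝ η).smulRight ξ), fun v => ?_, ?_⟩
  · simp only [smul_apply, sub_apply,
      ContinuousLinearMap.smulRight_apply, innerSL_apply_apply, inner_smul_right, inner_sub_right,
      real_inner_comm v]
    ring
  · have h0 : ‖ξ‖ ^ 2 ≠ 0 := pow_ne_zero _ (norm_ne_zero_iff.2 hξ)
    simp [innerSL_apply_apply, real_inner_comm ξ η, h, smul_smul, h0]

theorem sum_modePairing_eq_zero {m : ℕ} {F : MixedTensorDistribution n m} (hF : MRT m F = 0)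
    {ξ η : Space n} (hξ : ξ ≠ 0) (h : inner ℝ ξ η = 0) {j : ℕ} (hj : j ≤ m) :
    ∑ p, modePairing (F p) j ξ η = 0 := by
  obtain ⟨A, hA, rfl⟩ := exists_skew_apply_eq hξ h
  -- The mode of order `j` sits in the coefficient of `s^(m-j)`, with a nonzero binomial factor.
  have key := coeff_eq_zero_of_forall_ne_zero (N := m + 1)
    (c := fun k => (-1) ^ k * m.choose k * ∑ p, modePairing (F p) (m - k) ξ (A ξ))
    (fun s _ => by
      rw [← shiftedPairing_eq_sum]
      exact shiftedPairing_eq_zero hF hA hξ) (m - j) (by omega)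
  have hc : (m.choose (m - j) : ℂ) ≠ 0 :=
    Nat.cast_ne_zero.2 (Nat.choose_pos (Nat.sub_le m j)).ne'
  simp only [Nat.sub_sub_self hj] at key
  exact (mul_eq_zero.1 key).resolve_left (mul_ne_zero (pow_ne_zero _ (by norm_num)) hc)

theorem modePairing_smul {p : ℕ} (f : SymTensorDistribution n p) (j : ℕ) (r : ℝ) (ξ η : Space n) :
    modePairing f j (r • ξ) η = (r : ℂ) ^ p * ((r : ℂ) ^ j * modePairing f j ξ η) := by
  simp only [modePairing, monomial_smul, mode_smul, map_smul, smul_eq_mul, Finset.mul_sum]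
  exact Finset.sum_congr rfl fun i _ => by ring

/-- Replacing `ξ` by `rξ` preserves orthogonality to `η` and multiplies the rank `p` term by
`r^(p+j)`. For fixed `j` these powers are distinct, so each rank vanishes separately. -/
theorem modePairing_eq_zero {m : ℕ} {F : MixedTensorDistribution n m} (hF : MRT m F = 0)
    {ξ η : Space n} (hξ : ξ ≠ 0) (h : inner ℝ ξ η = 0) {j : ℕ} (hj : j ≤ m) (p : Fin (m + 1)) :
    modePairing (F p) j ξ η = 0 := by
  have key := coeff_eq_zero_of_forall_ne_zero (N := m + 1)
    (c := fun k => if hk : k < m + 1 then modePairing (F ⟨k, hk⟩) j ξ η else 0)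
    (fun r hr => by
      have h1 := sum_modePairing_eq_zero hF (smul_ne_zero hr hξ)
        (by rw [real_inner_smul_left, h, mul_zero]) hj
      simp only [modePairing_smul] at h1
      rw [Finset.sum_range]
      have h2 : (r : ℂ) ^ j * ∑ k : Fin (m + 1), (r : ℂ) ^ (k : ℕ) *
          (if hk : (k : ℕ) < m + 1 then modePairing (F ⟨k, hk⟩) j ξ η else 0) = 0 := by
        rw [← h1, Finset.mul_sum]
        refine Finset.sum_congr rfl fun k _ => ?_
        rw [dif_pos k.2]
        ring
      exact (mul_eq_zero.1 h2).resolve_left (pow_ne_zero _ (by exact_mod_cast hr))) p p.2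
  simpa [Nat.lt_succ_iff.1 p.2] using key

/-! ### Taylor expansion and polynomials along lines. -/

/-- The Taylor expansion of the exponential with entire remainder. -/
theorem exists_exp_eq_sum_add (m : ℕ) : ∃ (c : ℕ → ℂ) (H : ℂ → ℂ), Differentiable ℂ H ∧
    ∀ z, Complex.exp z = ∑ k ∈ Finset.range m, c k * z ^ k + z ^ m * H z := by
  induction m with
  | zero => exact ⟨0, Complex.exp, Complex.differentiable_exp, by simp⟩
  | succ m ih =>
    obtain ⟨c, H, hH, h⟩ := ih
    -- Split `H z = H 0 + z * dslope H 0 z`; the divided slope is entire by removability of the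
    -- singularity.
    refine ⟨Function.update c m (H 0), dslope H 0, ?_, fun z => ?_⟩
    · rw [← differentiableOn_univ, Complex.differentiableOn_dslope Filter.univ_mem,
        differentiableOn_univ]
      exact hH
    · have h1 : H z = H 0 + z * dslope H 0 z := by
        have := sub_smul_dslope H 0 z
        rw [sub_zero, smul_eq_mul] at this
        rw [this]
        ring
      have h2 : ∑ k ∈ Finset.range m, Function.update c m (H 0) k * z ^ k =
          ∑ k ∈ Finset.range m, c k * z ^ k :=
        Finset.sum_congr rfl fun k hk => by
          rw [Function.update_of_ne (Finset.mem_range.1 hk).ne]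
      rw [h, Finset.sum_range_succ, h2, Function.update_self]
      nth_rewrite 1 [h1]
      ring

/-- A polynomial of degree at most `m` that vanishes to order `m + 1` at the origin is zero. -/
theorem polynomial_eq_zero_of_eval_eq_pow_mul {P : Polynomial ℂ} {m : ℕ} (hP : P.natDegree ≤ m)
    {Q : ℝ → ℂ} (hQ : Continuous Q) (h : ∀ t : ℝ, P.eval (t : ℂ) = (t : ℂ) ^ (m + 1) * Q t) :
    P = 0 := by
  by_contra hne
  -- Write `P = X^k S` with `X ∤ S` and `k ≤ m`. Cancelling `t^k` leaves a positive power of `t` on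
  -- the right, so `S` vanishes at the origin by continuity, a contradiction.
  obtain ⟨S, hS, hS'⟩ := Polynomial.exists_eq_pow_rootMultiplicity_mul_and_not_dvd P hne 0
  set k := P.rootMultiplicity 0
  have hk : k ≤ m := by
    have h1 := (Multiset.count_le_card 0 P.roots).trans P.card_roots'
    rw [Polynomial.count_roots] at h1
    exact h1.trans hP
  rw [map_zero, sub_zero] at hS hS'
  refine hS' (Polynomial.X_dvd_iff.2 ?_)
  rw [Polynomial.coeff_zero_eq_eval_zero]
  have heq : ∀ t : ℝ, t ≠ 0 → S.eval (t : ℂ) = (t : ℂ) ^ (m + 1 - k) * Q t := by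
    intro t ht
    have ht' : (t : ℂ) ^ k ≠ 0 := pow_ne_zero _ (by exact_mod_cast ht)
    refine mul_left_cancel₀ ht' ?_
    rw [← mul_assoc, ← pow_add, Nat.add_sub_cancel' (hk.trans m.le_succ), ← h t]
    conv_rhs => rw [hS]
    simp
  have hc1 : Continuous fun t : ℝ => S.eval (t : ℂ) :=
    S.continuous.comp Complex.continuous_ofReal
  have hc2 : Continuous fun t : ℝ => (t : ℂ) ^ (m + 1 - k) * Q t :=
    (Complex.continuous_ofReal.pow _).mul hQ
  have := congrFun (Continuous.ext_on (dense_compl_singleton (0 : ℝ)) hc1 hc2 heq) 0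
  have hk' : m + 1 - k ≠ 0 := by omega
  simpa [hk'] using this

theorem natDegree_sum_monomial_line_le {p : ℕ} (c : (Fin p → Fin n) → ℂ) (ξ η : Space n) :
    (∑ i : Fin p → Fin n, Polynomial.C (c i) *
      ∏ k, (Polynomial.C (ξ (i k) : ℂ) + Polynomial.C (η (i k) : ℂ) * Polynomial.X)).natDegree
        ≤ p := by
  refine Polynomial.natDegree_sum_le_of_forall_le _ _ fun i _ => ?_
  refine (Polynomial.natDegree_C_mul_le _ _).trans ((Polynomial.natDegree_prod_le _ _).trans ?_)
  calc _ ≤ ∑ _k : Fin p, 1 := Finset.sum_le_sum fun k _ => by compute_degree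
    _ = p := by simp

/-- Vanishing of the mode pairings on all orthogonal pairs forces the Fourier transform to vanish
along lines. -/
theorem sum_monomial_line_eq_zero {p m : ℕ} (hp : p ≤ m) {f : SymTensorDistribution n p} {R : ℝ}
    (hR : ∀ i, BoundedOnBall (f.1 i).1 R)
    (hf : ∀ ξ η : Space n, ξ ≠ 0 → inner ℝ ξ η = 0 → ∀ j ≤ m, modePairing f j ξ η = 0)
    {ξ η : Space n} (hξ : ξ ≠ 0) (h : inner ℝ ξ η = 0) (t : ℝ) :
    ∑ i, monomial i (ξ + t • η) * (f.1 i).1 (wave η) = 0 := by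
  obtain ⟨c, H, hH, hexp⟩ := exists_exp_eq_sum_add (m + 1)
  have hHs : ContDiff ℝ ∞ H := hH.contDiff.restrict_scalars ℝ
  have hline : ContDiff ℝ ∞ fun t : ℝ => ξ + t • η :=
    contDiff_const.add (contDiff_id.smul contDiff_const)
  have hne : ∀ t : ℝ, ξ + t • η ≠ 0 := by
    intro t h0
    have h1 : inner ℝ ξ (ξ + t • η) = 0 := by rw [h0, inner_zero_right]
    rw [inner_add_right, inner_smul_right, h, mul_zero, add_zero, inner_self_eq_zero] at h1
    exact hξ h1
  have hne2 : ∀ t : ℝ, ‖ξ + t • η‖ ^ 2 ≠ 0 := fun t => pow_ne_zero _ (norm_ne_zero_iff.2 (hne t))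
  have hinner : ∀ t : ℝ, inner ℝ (ξ + t • η) η = t * ‖η‖ ^ 2 := fun t => by
    rw [inner_add_left, real_inner_smul_left, h, zero_add, real_inner_self_eq_norm_sq]
  -- Orthogonal decomposition `η = ζ t + t κ(t) (ξ + tη)`. The component along `ξ + tη` carries an
  -- explicit factor `t` because `ξ ⟂ η`.
  let κ : ℝ → ℝ := fun t => ‖η‖ ^ 2 / ‖ξ + t • η‖ ^ 2
  have hκ : ContDiff ℝ ∞ κ := contDiff_const.div (hline.norm_sq ℝ) hne2
  let ζ : ℝ → Space n := fun t => η - (t * κ t) • (ξ + t • η)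
  have hζ : ContDiff ℝ ∞ ζ := contDiff_const.sub ((contDiff_id.mul hκ).smul hline)
  have horth : ∀ t, inner ℝ (ξ + t • η) (ζ t) = 0 := fun t => by
    simp only [ζ, κ]
    rw [inner_sub_right, inner_smul_right, hinner, real_inner_self_eq_norm_sq, mul_assoc,
      div_mul_cancel₀ _ (hne2 t), sub_self]
  -- The Taylor remainder of the wave about the frequency `ζ t`, with `t^(m+1)` divided out; it
  -- stays smooth through `t = 0`.
  let Φ : ℝ → Space n → ℂ := fun t x =>
    ((κ t : ℂ) * (((inner ℝ x (ξ + t • η) : ℝ) : ℂ) * Complex.I)) ^ (m + 1) *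
      H ((t : ℂ) * (κ t : ℂ) * (((inner ℝ x (ξ + t • η) : ℝ) : ℂ) * Complex.I)) *
        Complex.exp (((inner ℝ x (ζ t) : ℝ) : ℂ) * Complex.I)
  have hΦ : ContDiff ℝ ∞ (uncurry Φ) := by
    have h1 : ContDiff ℝ ∞ fun q : ℝ × Space n =>
        ((inner ℝ q.2 (ξ + q.1 • η) : ℝ) : ℂ) * Complex.I :=
      (contDiff_inner_ofReal contDiff_snd (hline.comp contDiff_fst)).mul contDiff_const
    have h2 : ContDiff ℝ ∞ fun q : ℝ × Space n => (κ q.1 : ℂ) :=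
      Complex.ofRealCLM.contDiff.comp (hκ.comp contDiff_fst)
    have h3 : ContDiff ℝ ∞ fun q : ℝ × Space n => (q.1 : ℂ) :=
      Complex.ofRealCLM.contDiff.comp contDiff_fst
    exact (((h2.mul h1).pow _).mul (hHs.comp ((h3.mul h2).mul h1))).mul
      (contDiff_exp_inner contDiff_snd (hζ.comp contDiff_fst))
  have hwave : ∀ t : ℝ, wave η = ∑ k ∈ Finset.range (m + 1),
      (c k * ((t : ℂ) * (κ t : ℂ) * Complex.I) ^ k) • mode k (ξ + t • η) (ζ t) +
        (t : ℂ) ^ (m + 1) • member hΦ t := by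
    intro t
    refine Subtype.ext (funext fun x => ?_)
    have h1 : inner ℝ x η = inner ℝ x (ζ t) + t * κ t * inner ℝ x (ξ + t • η) := by
      simp only [ζ]
      rw [inner_sub_right, inner_smul_right, sub_add_cancel]
    have h2 : (wave η : Space n → ℂ) x = Complex.exp (((inner ℝ x (ζ t) : ℝ) : ℂ) * Complex.I) *
        Complex.exp ((t : ℂ) * (κ t : ℂ) * (((inner ℝ x (ξ + t • η) : ℝ) : ℂ) * Complex.I)) := by
      rw [← Complex.exp_add]
      simp only [wave, h1]
      push_cast
      ring_nf
    rw [h2, hexp (_ * _ * _), Submodule.coe_add, AddSubmonoidClass.coe_finsetSum, Pi.add_apply,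
      Finset.sum_apply, mul_add, Finset.mul_sum]
    simp only [member, mode, wave, Submodule.coe_smul, Pi.smul_apply, smul_eq_mul, Φ]
    refine congrArg₂ (· + ·) (Finset.sum_congr rfl fun k _ => ?_) ?_
    · ring
    · ring
  let Q : ℝ → ℂ := fun t => ∑ i, monomial i (ξ + t • η) * (f.1 i).1 (member hΦ t)
  have hQ : Continuous Q := continuous_finsetSum _ fun i _ =>
    ((contDiff_monomial i).comp hline).continuous.mul ((hR i).continuous_apply_member hΦ)
  have hsum : ∀ t : ℝ, ∑ i, monomial i (ξ + t • η) * (f.1 i).1 (wave η) =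
      (t : ℂ) ^ (m + 1) * Q t := by
    intro t
    -- The Taylor terms of order at most `m` are modes at the orthogonal pair `(ξ + tη, ζ t)`, so
    -- only the remainder survives.
    have h1 : ∀ k ∈ Finset.range (m + 1), modePairing f k (ξ + t • η) (ζ t) = 0 := fun k hk =>
      hf _ _ (hne t) (horth t) k (Nat.lt_succ_iff.1 (Finset.mem_range.1 hk))
    have h2 : ∑ k ∈ Finset.range (m + 1), (c k * ((t : ℂ) * (κ t : ℂ) * Complex.I) ^ k) *
        modePairing f k (ξ + t • η) (ζ t) = 0 :=
      Finset.sum_eq_zero fun k hk => by rw [h1 k hk, mul_zero]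
    rw [← zero_add ((t : ℂ) ^ (m + 1) * Q t), ← h2]
    simp only [modePairing, Q, Finset.mul_sum]
    rw [Finset.sum_comm, ← Finset.sum_add_distrib]
    refine Finset.sum_congr rfl fun i _ => ?_
    conv_lhs => rw [hwave t]
    rw [map_add, map_sum, mul_add, Finset.mul_sum]
    simp only [map_smul, smul_eq_mul]
    refine congrArg₂ (· + ·) (Finset.sum_congr rfl fun k _ => ?_) ?_
    · ring
    · ring
  have heval : ∀ t : ℝ, (∑ i : Fin p → Fin n, Polynomial.C ((f.1 i).1 (wave η)) *
      ∏ k, (Polynomial.C (ξ (i k) : ℂ) + Polynomial.C (η (i k) : ℂ) * Polynomial.X)).eval (t : ℂ) =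
      ∑ i, monomial i (ξ + t • η) * (f.1 i).1 (wave η) := by
    intro t
    rw [Polynomial.eval_finsetSum]
    refine Finset.sum_congr rfl fun i _ => ?_
    rw [Polynomial.eval_mul, Polynomial.eval_C, Polynomial.eval_prod, mul_comm]
    simp [monomial, mul_comm (t : ℂ)]
  have hzero := polynomial_eq_zero_of_eval_eq_pow_mul
    ((natDegree_sum_monomial_line_le (fun i => (f.1 i).1 (wave η)) ξ η).trans hp) hQ
    fun t => by rw [heval, hsum]
  rw [← heval t, hzero, Polynomial.eval_zero]

/-! ### From symmetric forms to components, and conclusion. -/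

/-- Equal multisets of values have fibres of equal size; bijections between the fibres glue to a
permutation. -/
theorem exists_perm_of_map_univ_eq {α β : Type*} [Fintype α] [DecidableEq β] {f g : α → β}
    (h : Finset.univ.val.map f = Finset.univ.val.map g) : ∃ σ : Equiv.Perm α, f = g ∘ σ := by
  have hcard : ∀ b, Nonempty ({a // f a = b} ≃ {a // g a = b}) := fun b => by
    rw [← Fintype.card_eq, Fintype.card_subtype, Fintype.card_subtype]
    have := congrArg (Multiset.count b) h
    rw [Multiset.count_map, Multiset.count_map] at this
    simpa only [Finset.card, Finset.filter_val, eq_comm] using this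
  let e := fun b => (hcard b).some
  exact ⟨Equiv.ofFiberEquiv e, funext fun a => (Equiv.ofFiberEquiv_map e a).symm⟩

/-- A symmetric tensor whose associated form vanishes is zero. -/
theorem symmetric_eq_zero_of_form_eq_zero {p : ℕ} {c : (Fin p → Fin n) → ℂ}
    (hc : ∀ (σ : Equiv.Perm (Fin p)) i, c (i ∘ σ) = c i)
    (h : ∀ ξ : Space n, ∑ i, monomial i ξ * c i = 0) (i : Fin p → Fin n) : c i = 0 := by
  let d : (Fin p → Fin n) → Fin n →₀ ℕ := fun i => Multiset.toFinsupp (Finset.univ.val.map i)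
  let P : MvPolynomial (Fin n) ℂ := ∑ i, MvPolynomial.monomial (d i) (c i)
  have hd : ∀ (i : Fin p → Fin n) (a : ℂ) (ξ : Fin n → ℂ),
      MvPolynomial.eval ξ (MvPolynomial.monomial (d i) a) = a * ∏ k, ξ (i k) := by
    intro i a ξ
    have h1 : (d i).prod (fun k e => ξ k ^ e) = ∏ k, ξ (i k) := by
      have h2 := Finset.prod_multiset_map_count (Finset.univ.val.map i) ξ
      rw [Multiset.map_map] at h2
      exact h2.symm
    rw [MvPolynomial.eval_monomial, h1]
  have hP : P = 0 := by
    refine MvPolynomial.funext_set (fun _ => Set.range ((↑) : ℝ → ℂ))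
      (fun _ => Set.infinite_range_of_injective Complex.ofReal_injective) fun ξ hξ => ?_
    choose x hx using fun k => hξ k trivial
    rw [map_zero, map_sum, ← h (WithLp.toLp 2 x)]
    refine Finset.sum_congr rfl fun i _ => ?_
    rw [hd, mul_comm]
    simp [monomial, hx]
  have hcoeff := congrArg (MvPolynomial.coeff (d i)) hP
  -- Indices with the same exponent form one permutation orbit, on which `c` is constant. The
  -- coefficient of `P` is therefore the nonzero orbit size times `c i`.
  have hterm : ∀ i', (if d i' = d i then c i' else 0) = (if d i' = d i then 1 else 0) * c i := by
    intro i'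
    split_ifs with h1
    · obtain ⟨σ, hσ⟩ := exists_perm_of_map_univ_eq (Multiset.toFinsupp.injective h1)
      rw [hσ, hc, one_mul]
    · rw [zero_mul]
  simp only [P, MvPolynomial.coeff_sum, MvPolynomial.coeff_monomial, MvPolynomial.coeff_zero, hterm,
    ← Finset.sum_mul, Finset.sum_boole] at hcoeff
  refine (mul_eq_zero.1 hcoeff).resolve_left (Nat.cast_ne_zero.2 (Finset.card_ne_zero.2 ⟨i, ?_⟩))
  simp

theorem exists_orthogonal_ne_zero (hn : 2 ≤ n) (η : Space n) :
    ∃ v : Space n, v ≠ 0 ∧ inner ℝ v η = 0 := by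
  have hne : (Submodule.span ℝ {η})ᗮ ≠ ⊥ := by
    intro h
    rw [Submodule.orthogonal_eq_bot_iff] at h
    have h1 := finrank_span_le_card (R := ℝ) ({η} : Set (Space n))
    rw [h, finrank_top, finrank_euclideanSpace_fin, Set.toFinset_singleton,
      Finset.card_singleton] at h1
    omega
  obtain ⟨v, hv, hv0⟩ := Submodule.exists_mem_ne_zero_of_ne_bot hne
  exact ⟨v, hv0, Submodule.mem_orthogonal_singleton_iff_inner_left.1 hv⟩
-- Any `ξ` not parallel to `η` lies on a line `ξ' + tη` with `0 ≠ ξ' ⟂ η`, where the form vanishes.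
-- A parallel `ξ` is a limit of such points along a direction `v ⟂ η`, which exists since `n ≥ 2`.
theorem apply_wave_eq_zero (hn : 2 ≤ n) {p m : ℕ} (hp : p ≤ m) {f : SymTensorDistribution n p}
    {R : ℝ} (hR : ∀ i, BoundedOnBall (f.1 i).1 R)
    (hf : ∀ ξ η : Space n, ξ ≠ 0 → inner ℝ ξ η = 0 → ∀ j ≤ m, modePairing f j ξ η = 0)
    {η : Space n} (hη : η ≠ 0) (i : Fin p → Fin n) : (f.1 i).1 (wave η) = 0 := by
  have hgen : ∀ ξ : Space n, ξ - (inner ℝ ξ η / ‖η‖ ^ 2) • η ≠ 0 →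
      ∑ i, monomial i ξ * (f.1 i).1 (wave η) = 0 := by
    intro ξ hξ
    have h1 : inner ℝ (ξ - (inner ℝ ξ η / ‖η‖ ^ 2) • η) η = 0 := by
      rw [inner_sub_left, real_inner_smul_left, real_inner_self_eq_norm_sq,
        div_mul_cancel₀ _ (pow_ne_zero _ (norm_ne_zero_iff.2 hη)), sub_self]
    have h2 := sum_monomial_line_eq_zero hp hR hf hξ h1 (inner ℝ ξ η / ‖η‖ ^ 2)
    rwa [sub_add_cancel] at h2
  refine symmetric_eq_zero_of_form_eq_zero (c := fun i => (f.1 i).1 (wave η))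
    (fun σ i => by rw [f.2 σ i]) (fun ξ => ?_) i
  by_cases hξ : ξ - (inner ℝ ξ η / ‖η‖ ^ 2) • η = 0
  · obtain ⟨v, hv, hvη⟩ := exists_orthogonal_ne_zero hn η
    have hc : Continuous fun t : ℝ => ∑ i, monomial i (ξ + t • v) * (f.1 i).1 (wave η) :=
      continuous_finsetSum _ fun i _ => ((contDiff_monomial i).continuous.comp
        (continuous_const.add (continuous_id.smul continuous_const))).mul continuous_const
    have h0 := congrFun (Continuous.ext_on (dense_compl_singleton (0 : ℝ)) hc
      (continuous_const (y := (0 : ℂ))) fun t ht => hgen _ ?_) 0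
    · simpa using h0
    · rw [inner_add_left, real_inner_smul_left, hvη, mul_zero, add_zero, add_sub_right_comm, hξ,
        zero_add]
      exact smul_ne_zero ht hv
  · exact hgen ξ hξ

/-- The momentum ray transform of order `m` is injective on `𝓔'(𝐒^m)`. -/
theorem eq_zero_of_MRT_eq_zero {m : ℕ} (hn : 2 ≤ n) {F : MixedTensorDistribution n m}
    (hF : MRT m F = 0) : F = 0 := by
  obtain ⟨R, hR⟩ := exists_boundedOnBall F
  funext p
  refine Subtype.ext (funext fun i => Subtype.ext ?_)
  refine (hR p i).eq_zero_of_wave fun η => ?_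
  have hwave : ContDiff ℝ ∞ (Function.uncurry fun η : Space n => (wave η : Space n → ℂ)) :=
    contDiff_exp_inner contDiff_snd contDiff_fst
  have hc : Continuous fun η => ((F p).1 i).1 (wave η) := (hR p i).continuous_apply_member hwave
  have : Nonempty (Fin n) := ⟨⟨0, by omega⟩⟩
  have : Nontrivial (Space n) := inferInstance
  have : (nhdsWithin (0 : Space n) {0}ᶜ).NeBot := Module.punctured_nhds_neBot ℝ (Space n) 0
  -- Zero frequency is excluded above, so it is recovered by continuity in `η`.
  refine congrFun (Continuous.ext_on (dense_compl_singleton (0 : Space n)) hc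
    (continuous_const (y := (0 : ℂ))) fun η hη => ?_) η
  exact apply_wave_eq_zero hn (Nat.lt_succ_iff.1 p.2) (hR p)
    (fun ξ η hξ h j hj => modePairing_eq_zero hF hξ h hj p) hη i

end MomentumRay

end

theorem mainTheorem3 (n m : ℕ) (hn : 2 ≤ n) (F : MomentumRay.MixedTensorDistribution n m)
    (hF : MomentumRay.MRT m F = 0) : F = 0 := by
  exact MomentumRay.eq_zero_of_MRT_eq_zero hn hF
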